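/- Let $M$ be a smooth finite-dimensional manifold (Hausdorff, second countable) with a pseudo-Riemannian metric $g$ of any signature, Levi-Civita connection $\nabla$, curvature $R(X,Y)Z=\nabla_X\nabla_YZ-\nabla_Y\nabla_XZ-\nabla_{[X,Y]}Z$, $R(\partial_a,\partial_b)\partial_c=R^d{}_{cab}\,\partial_d$, Ricci tensor $R_{cb}=R^a{}_{cab}$, and let $\mu\ne 0$ be real. "To order $\lambda^2$" means that all algebras are over $\mathbb C[\lambda]/(\lambda^3)$, with $\lambda$ a formal parameter. Let $\mathcal D(M)$ be the associative unital algebra generated by smooth functions and vector fields on $M$ with relations $[f,h]=0$, $[X,f]=\lambda X(f)$, $[Y,X]=\lambda[Y,X]_{\rm Lie}$, $f.X=fX$ (the products and linear combinations with constants of functions, and the sums of vector fields, being the classical ones). Let $\mathcal C$ be the (not necessarily associative) algebra generated by $\mathcal D(M)$, as an associative subalgebra with the same unit, by symbols $\widehat\xi$, linear in the 1-form $\xi\in\Omega^1(M)$, and by a 1-form $\theta'$ which commutes and associates with the elements of $\mathcal D(M)$, subject to $$f\,\widehat\xi=\widehat{f\xi}-\tfrac{\lambda}{2\mu}g^{ij}f_{,i}\xi_j\,\theta',\qquad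 \widehat\xi\, f=\widehat{f\xi}+\tfrac{\lambda}{2\mu}g^{ij}f_{,i}\xi_j\,\theta',$$ $$[X,\widehat\xi\,]=\lambda\,\widehat{\nabla_X\xi}-\tfrac{\lambda}{\mu}\,\theta'\,(g^{ij}\xi_i\nabla_jX)-\tfrac{\lambda^2}{2\mu}\,\theta'\big(X^a\xi_p\,g^{pq}R_{qa}+g^{ij}X^a{}_{;j}\,\xi_{i;a}\big).$$ Here $[x,y]=xy-yx$ in $\mathcal C$; put $J(x,y,z)=[x,[y,z]]+[z,[x,y]]+[y,[z,x]]$. Then for all functions $f,h\in C^\infty(M)$, vector fields $X,Y$ and 1-forms $\xi$ on $M$: $$J(f,h,\widehat\xi\,)=0,\qquad J(f,Y,\widehat\xi\,)=0,\qquad J(Y,X,\widehat\xi\,)=\lambda^2\big(\widehat\zeta-\mu^{-1}\theta'\,\zeta^\sharp\big),$$ where $\zeta$ is the 1-form $\zeta(Z)=\xi(R(X,Y)Z)$, i.e. $\zeta=Y^aX^c\xi_iR^i{}_{jca}\,dx^j$, and $\zeta^\sharp=g^{ej}\zeta_j\,\partial_e$. Equivalently $$J(Y,X,\widehat\xi\,)=\lambda^2\,Y^aX^c\xi_i\,R^i{}_{jca}\big(\widehat{dx^j}-\mu^{-1}\theta'\,g^{ej}\partial_e\big),$$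 in global coordinates, and more generally with $\partial_i,dx^i$ replaced by any finite family of vector fields $e_i$ and 1-forms $\varepsilon^i$ such that $Z=\sum_i\varepsilon^i(Z)e_i$ for every vector field $Z$. Consequently $J(Y,X,\widehat\xi\,)\neq0$ for some $X,Y,\xi$ if and only if the Riemann curvature of $g$ is not identically zero; in that case associativity fails at order $\lambda^2$. -/

import Mathlib

open scoped Manifold ContDiff BigOperators

noncomputable section

namespace DiffOpCalculus

/-! ### Scalars: complex polynomials in a formal parameter, with its cube discarded -/

/-- The ground ring `ℂ[λ]/(λ³)`: working "to order `λ²`" means discarding `λ³`. -/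
abbrev Scalar : Type := AdjoinRoot (Polynomial.X ^ 3 : Polynomial ℂ)

/-- The deformation parameter `λ`. -/
def lam : Scalar := AdjoinRoot.root (Polynomial.X ^ 3 : Polynomial ℂ)

/-- Real numbers as scalars. -/
def realScalar : ℝ →+* Scalar := (algebraMap ℂ Scalar).comp (algebraMap ℝ ℂ)

/-! ### Classical geometry over the algebra of real smooth functions

For `A = C^∞(M)`, with `M` a finite-dimensional second countable Hausdorff manifold, derivations of
`A` are the smooth vector fields and `A`-linear forms on them are the smooth 1-forms. -/

section Geometry

variable (A : Type*) [CommRing A] [Algebra ℝ A]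

/-- Vector fields. -/
abbrev Vec : Type _ := Derivation ℝ A A

/-- 1-forms. -/
abbrev Form : Type _ := Module.Dual A (Vec A)

/-- A (pseudo-Riemannian) metric: symmetric, with musical map an isomorphism from vector fields
to 1-forms, which is pointwise non-degeneracy. No signature is prescribed. -/
structure Metric where
  inner : Vec A →ₗ[A] Vec A →ₗ[A] A
  symm : ∀ X Y, inner X Y = inner Y X
  nondegenerate : Function.Bijective inner

/-- An affine connection, as a covariant derivative `∇_X Y` of vector fields. -/
structure Connection where
  nabla : Vec A → Vec A → Vec A
  add_left : ∀ X X' Y, nabla (X + X') Y = nabla X Y + nabla X' Y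
  smul_left : ∀ (f : A) X Y, nabla (f • X) Y = f • nabla X Y
  add_right : ∀ X Y Y', nabla X (Y + Y') = nabla X Y + nabla X Y'
  leibniz : ∀ X (f : A) Y, nabla X (f • Y) = X f • Y + f • nabla X Y

variable {A}

/-- The classical differential `df` of a function. -/
def dForm (f : A) : Form A where
  toFun X := X f
  map_add' _ _ := rfl
  map_smul' _ _ := rfl

namespace Metric

variable (g : Metric A)

/-- The 1-form to vector field isomorphism, `ξ ↦ g^{ij} ξ_j ∂_i`. -/
def sharp : Form A ≃ₗ[A] Vec A := (LinearEquiv.ofBijective g.inner g.nondegenerate).symm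

/-- The inverse metric on 1-forms, `(ξ, η) = g^{ij} ξ_i η_j`. -/
def coInner (ξ η : Form A) : A := ξ (g.sharp η)

@[simp] theorem inner_sharp (ξ : Form A) (Z : Vec A) : g.inner (g.sharp ξ) Z = ξ Z := by
  have h : g.inner (g.sharp ξ) = ξ :=
    (LinearEquiv.ofBijective g.inner g.nondegenerate).apply_symm_apply ξ
  rw [h]

theorem ext_inner {X Y : Vec A} (h : ∀ Z, g.inner X Z = g.inner Y Z) : X = Y :=
  g.nondegenerate.1 (LinearMap.ext h)

theorem lie_smul_right (X Y : Vec A) (f : A) : ⁅X, f • Y⁆ = X f • Y + f • ⁅X, Y⁆ := by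
  ext a
  simp only [Derivation.commutator_apply, Derivation.smul_apply, Derivation.add_apply,
    Derivation.leibniz, smul_eq_mul]
  ring

theorem lie_smul_left (X Y : Vec A) (f : A) : ⁅f • X, Y⁆ = f • ⁅X, Y⁆ - Y f • X := by
  ext a
  simp only [Derivation.commutator_apply, Derivation.smul_apply, Derivation.sub_apply,
    Derivation.leibniz, smul_eq_mul]
  ring

/-- Right hand side of the Koszul formula for `2 g(∇_X Y, Z)`. -/
def koszulFun (X Y Z : Vec A) : A :=
  X (g.inner Y Z) + Y (g.inner Z X) - Z (g.inner X Y)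
    + g.inner ⁅X, Y⁆ Z - g.inner ⁅Y, Z⁆ X + g.inner ⁅Z, X⁆ Y

/-- `Z ↦ ½ koszulFun X Y Z` as a 1-form. -/
def koszul (X Y : Vec A) : Form A where
  toFun Z := (1 / 2 : ℝ) • g.koszulFun X Y Z
  map_add' Z W := by
    rw [← smul_add]
    congr 1
    simp only [koszulFun, map_add, LinearMap.add_apply, Derivation.add_apply, lie_add, add_lie]
    ring
  map_smul' f Z := by
    rw [RingHom.id_apply, smul_comm]
    congr 1
    simp only [koszulFun, map_smul, LinearMap.smul_apply, Derivation.smul_apply, lie_smul_right,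
      lie_smul_left, map_add, map_sub, LinearMap.add_apply, LinearMap.sub_apply,
      Derivation.leibniz, smul_eq_mul]
    rw [g.symm Z Y]
    ring

theorem two_koszul (X Y Z : Vec A) :
    g.koszul X Y Z + g.koszul X Y Z = g.koszulFun X Y Z := by
  change (1 / 2 : ℝ) • g.koszulFun X Y Z + (1 / 2 : ℝ) • g.koszulFun X Y Z = g.koszulFun X Y Z
  rw [← add_smul]
  norm_num

theorem two_cancel {a b : A} (h : a + a = b + b) : a = b := by
  have : (2 : ℝ) • a = (2 : ℝ) • b := by simpa [two_smul] using h
  have h2 := congrArg (fun x => (1 / 2 : ℝ) • x) this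
  simpa [smul_smul] using h2

theorem two_nabla (X Y Z : Vec A) :
    g.inner (g.sharp (g.koszul X Y)) Z + g.inner (g.sharp (g.koszul X Y)) Z
      = g.koszulFun X Y Z := by
  rw [inner_sharp, two_koszul]

/-- The Levi-Civita connection, defined by the Koszul formula. -/
def leviCivita : Connection A where
  nabla X Y := g.sharp (g.koszul X Y)
  add_left X X' Y := by
    refine g.ext_inner fun Z => two_cancel ?_
    rw [two_nabla, map_add, LinearMap.add_apply, add_add_add_comm, two_nabla, two_nabla]
    simp only [koszulFun, map_add, LinearMap.add_apply, Derivation.add_apply, lie_add, add_lie]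
    ring
  smul_left f X Y := by
    refine g.ext_inner fun Z => two_cancel ?_
    rw [two_nabla, map_smul, LinearMap.smul_apply, ← smul_add, two_nabla]
    simp only [koszulFun, map_smul, LinearMap.smul_apply, Derivation.smul_apply, lie_smul_right,
      lie_smul_left, map_add, map_sub, LinearMap.add_apply, LinearMap.sub_apply,
      Derivation.leibniz, smul_eq_mul]
    rw [g.symm Z X, g.symm X Y]
    ring
  add_right X Y Y' := by
    refine g.ext_inner fun Z => two_cancel ?_
    rw [two_nabla, map_add, LinearMap.add_apply, add_add_add_comm, two_nabla, two_nabla]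
    simp only [koszulFun, map_add, LinearMap.add_apply, Derivation.add_apply, lie_add, add_lie]
    ring
  leibniz X f Y := by
    refine g.ext_inner fun Z => two_cancel ?_
    rw [two_nabla, map_add, LinearMap.add_apply, add_add_add_comm, map_smul, map_smul,
      LinearMap.smul_apply, LinearMap.smul_apply, ← smul_add, ← smul_add, two_nabla]
    simp only [koszulFun, map_smul, LinearMap.smul_apply, Derivation.smul_apply, lie_smul_right,
      lie_smul_left, map_add, map_sub, LinearMap.add_apply, LinearMap.sub_apply,
      Derivation.leibniz, smul_eq_mul]
    rw [g.symm Y X]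
    ring

/-- The Levi-Civita connection is torsion free. -/
theorem leviCivita_torsion_free (X Y : Vec A) :
    g.leviCivita.nabla X Y - g.leviCivita.nabla Y X = ⁅X, Y⁆ := by
  refine g.ext_inner fun Z => two_cancel ?_
  change g.inner (g.sharp (g.koszul X Y) - g.sharp (g.koszul Y X)) Z
    + g.inner (g.sharp (g.koszul X Y) - g.sharp (g.koszul Y X)) Z = _
  rw [map_sub, LinearMap.sub_apply, sub_add_sub_comm, two_nabla, two_nabla]
  simp only [koszulFun]
  rw [g.symm Z X, g.symm Z Y, g.symm Y X, ← lie_skew X Y, ← lie_skew Z Y, ← lie_skew X Z]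
  simp only [map_neg, LinearMap.neg_apply]
  ring

/-- The Levi-Civita connection preserves the metric. -/
theorem leviCivita_metric (X Y Z : Vec A) :
    X (g.inner Y Z) = g.inner (g.leviCivita.nabla X Y) Z + g.inner Y (g.leviCivita.nabla X Z) := by
  refine two_cancel ?_
  change _ = g.inner (g.sharp (g.koszul X Y)) Z + g.inner Y (g.sharp (g.koszul X Z))
    + (g.inner (g.sharp (g.koszul X Y)) Z + g.inner Y (g.sharp (g.koszul X Z)))
  rw [add_add_add_comm, two_nabla, g.symm Y (g.sharp _), two_nabla]
  simp only [koszulFun]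
  rw [g.symm Z X, g.symm Y X, g.symm Z Y, ← lie_skew X Y, ← lie_skew Z Y, ← lie_skew X Z]
  simp only [map_neg, LinearMap.neg_apply]
  ring

end Metric

namespace Connection

variable (D : Connection A)

/-- The covariant derivative of 1-forms, `(∇_X ξ)(Z) = X(ξ(Z)) - ξ(∇_X Z)`; in coordinates
`(∇_X ξ)_i = X^a ξ_{i;a}`. -/
def nablaForm (X : Vec A) (ξ : Form A) : Form A where
  toFun Z := X (ξ Z) - ξ (D.nabla X Z)
  map_add' Z W := by
    simp only [map_add, D.add_right]
    ring
  map_smul' f Z := by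
    simp only [map_smul, map_add, D.leibniz, Derivation.leibniz, smul_eq_mul, RingHom.id_apply]
    ring

/-- The curvature `R(X,Y)Z = ∇_X ∇_Y Z - ∇_Y ∇_X Z - ∇_{[X,Y]} Z`, with components
`R(∂_a,∂_b)∂_c = R^d_{cab} ∂_d`. -/
def curvature (X Y Z : Vec A) : Vec A :=
  D.nabla X (D.nabla Y Z) - D.nabla Y (D.nabla X Z) - D.nabla ⁅X, Y⁆ Z

/-- `Z ↦ ξ(R(X,Y)Z)`, the 1-form `Y^a X^c ξ_i R^i_{jca} dx^j`. -/
def curvatureForm (ξ : Form A) (X Y : Vec A) : Form A where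
  toFun Z := ξ (D.curvature X Y Z)
  map_add' Z W := by
    simp only [curvature, D.add_right, map_add, map_sub]
    ring
  map_smul' f Z := by
    simp only [curvature, D.add_right, D.leibniz, map_add, map_sub, map_smul, smul_eq_mul,
      Derivation.commutator_apply, RingHom.id_apply]
    ring

end Connection

/-- A finite family of vector fields `e_i` and 1-forms `ε^i` with `Z = ∑ ε^i(Z) e_i` for all `Z`,
such as `∂_i` and `dx^i` for global coordinates `x^i`. -/
def IsDualFrame {n : ℕ} (e : Fin n → Vec A) (ε : Fin n → Form A) : Prop :=
  ∀ Z : Vec A, Z = ∑ i, ε i Z • e i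

/-- `a` is the contraction of a finite expansion `T = ∑ α^i ⊗ e_i`. -/
def IsTrace (T : Vec A → Vec A) (a : A) : Prop :=
  ∃ (n : ℕ) (e : Fin n → Vec A) (α : Fin n → Form A),
    (∀ Z, T Z = ∑ i, α i Z • e i) ∧ a = ∑ i, α i (e i)

open Classical in
/-- The trace of an endomorphism of vector fields (the function whose value at a point is the trace
of the endomorphism of the tangent space there). -/
def traceVec (T : Vec A → Vec A) : A := if h : ∃ a, IsTrace T a then h.choose else 0

theorem traceVec_eq {n : ℕ} {e : Fin n → Vec A} {ε : Fin n → Form A} (h : IsDualFrame e ε)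
    (T : Vec A →ₗ[A] Vec A) : traceVec T = ∑ i, ε i (T (e i)) := by
  have hex : ∃ a, IsTrace T a := by
    refine ⟨_, n, fun i => T (e i), ε, fun Z => ?_, rfl⟩
    conv_lhs => rw [h Z]
    simp
  rw [traceVec, dif_pos hex]
  obtain ⟨m, f, α, hT, ha⟩ := hex.choose_spec
  rw [ha]
  simp only [hT, map_sum, map_smul, smul_eq_mul]
  rw [Finset.sum_comm]
  refine Finset.sum_congr rfl fun k _ => ?_
  conv_lhs => rw [h (f k)]
  simp [mul_comm]

namespace Metric

variable (g : Metric A)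

/-- The Ricci tensor `R_{ab} X^a Y^b`, with `R_{cb} = R^a_{cab}`. -/
def ricci (X Y : Vec A) : A := traceVec fun Z => g.leviCivita.curvature Z X Y

/-- The full contraction `g^{ij} X^a_{;j} ξ_{i;a}`, as the trace of `Z ↦ ∇_{(∇_Z ξ)^♯} X`. -/
def derivContraction (X : Vec A) (ξ : Form A) : A :=
  traceVec fun Z => g.leviCivita.nabla (g.sharp (g.leviCivita.nablaForm Z ξ)) X

end Metric

end Geometry

/-! ### The algebra of differential operators -/

section DiffOp

variable (A : Type*) [CommRing A] [Algebra ℝ A]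

/-- Relations of the algebra of differential operators, between words in symbols for functions
and for vector fields. -/
inductive DiffOpRel :
    FreeAlgebra Scalar (A ⊕ Vec A) → FreeAlgebra Scalar (A ⊕ Vec A) → Prop
  | fn_const (r : ℝ) : DiffOpRel (FreeAlgebra.ι Scalar (Sum.inl (algebraMap ℝ A r)))
      (algebraMap Scalar _ (realScalar r))
  | fn_add (f h : A) : DiffOpRel (FreeAlgebra.ι Scalar (Sum.inl (f + h)))
      (FreeAlgebra.ι Scalar (Sum.inl f) + FreeAlgebra.ι Scalar (Sum.inl h))
  | fn_mul (f h : A) : DiffOpRel (FreeAlgebra.ι Scalar (Sum.inl (f * h)))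
      (FreeAlgebra.ι Scalar (Sum.inl f) * FreeAlgebra.ι Scalar (Sum.inl h))
  | vec_add (X Y : Vec A) : DiffOpRel (FreeAlgebra.ι Scalar (Sum.inr (X + Y)))
      (FreeAlgebra.ι Scalar (Sum.inr X) + FreeAlgebra.ι Scalar (Sum.inr Y))
  | fn_vec (f : A) (X : Vec A) : DiffOpRel (FreeAlgebra.ι Scalar (Sum.inr (f • X)))
      (FreeAlgebra.ι Scalar (Sum.inl f) * FreeAlgebra.ι Scalar (Sum.inr X))
  | vec_fn (X : Vec A) (f : A) : DiffOpRel
      (FreeAlgebra.ι Scalar (Sum.inr X) * FreeAlgebra.ι Scalar (Sum.inl f)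
        - FreeAlgebra.ι Scalar (Sum.inl f) * FreeAlgebra.ι Scalar (Sum.inr X))
      (lam • FreeAlgebra.ι Scalar (Sum.inl (X f)))
  | vec_vec (Y X : Vec A) : DiffOpRel
      (FreeAlgebra.ι Scalar (Sum.inr Y) * FreeAlgebra.ι Scalar (Sum.inr X)
        - FreeAlgebra.ι Scalar (Sum.inr X) * FreeAlgebra.ι Scalar (Sum.inr Y))
      (lam • FreeAlgebra.ι Scalar (Sum.inr ⁅Y, X⁆))

/-- The algebra of differential operators `𝒟`: the associative unital complex algebra, over the
truncated polynomials in `λ`, generated by functions and vector fields with relations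
`[X, f] = λ X(f)`, `[Y, X] = λ [Y, X]_Lie`, `[f, h] = 0` and `f . X = f X`. The complex functions
and vector fields are the complex combinations of the real ones used as generators. -/
abbrev DiffOp : Type _ := RingQuot (DiffOpRel A)

variable {A}

/-- A function as a differential operator. -/
def DiffOp.fn (f : A) : DiffOp A :=
  RingQuot.mkAlgHom Scalar (DiffOpRel A) (FreeAlgebra.ι Scalar (Sum.inl f))

/-- A vector field as a differential operator. -/
def DiffOp.vec (X : Vec A) : DiffOp A :=
  RingQuot.mkAlgHom Scalar (DiffOpRel A) (FreeAlgebra.ι Scalar (Sum.inr X))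

end DiffOp

/-! ### The calculus -/

section Calculus

variable {A : Type*} [CommRing A] [Algebra ℝ A]

/-- Generators: differential operators, the symbols `ξ̂` for 1-forms `ξ`, and `θ'`. -/
inductive Gen (A : Type*) [CommRing A] [Algebra ℝ A]
  | op (a : DiffOp A)
  | hat (ξ : Form A)
  | theta

/-- The free non-associative algebra on the generators. -/
abbrev FreeCalc (A : Type*) [CommRing A] [Algebra ℝ A] : Type _ :=
  FreeNonUnitalNonAssocAlgebra Scalar (Gen A)

/-- The free generator of a differential operator. -/
def opF (a : DiffOp A) : FreeCalc A := FreeNonUnitalNonAssocAlgebra.of Scalar (Gen.op a)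

/-- The free generator `ξ̂`. -/
def hatF (ξ : Form A) : FreeCalc A := FreeNonUnitalNonAssocAlgebra.of Scalar (Gen.hat ξ)

/-- The free generator `θ'`. -/
def thetaF : FreeCalc A := FreeNonUnitalNonAssocAlgebra.of Scalar Gen.theta

/-- `Relation g μ x y`: the relation `x = y` holds in the calculus, by definition.
No associativity is imposed on products of differential operators with the forms `ξ̂`. -/
inductive Relation (g : Metric A) (μ : ℝ) : FreeCalc A → FreeCalc A → Prop
  -- the differential operators form a subalgebra, whose unit is the unit
  | op_add (a b : DiffOp A) : Relation g μ (opF (a + b)) (opF a + opF b)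
  | op_smul (k : Scalar) (a : DiffOp A) : Relation g μ (opF (k • a)) (k • opF a)
  | op_mul (a b : DiffOp A) : Relation g μ (opF (a * b)) (opF a * opF b)
  | one_mul (x : FreeCalc A) : Relation g μ (opF 1 * x) x
  | mul_one (x : FreeCalc A) : Relation g μ (x * opF 1) x
  -- `ξ̂` is linear in `ξ`
  | hat_add (ξ η : Form A) : Relation g μ (hatF (ξ + η)) (hatF ξ + hatF η)
  | hat_smul (r : ℝ) (ξ : Form A) :
      Relation g μ (hatF (algebraMap ℝ A r • ξ)) (realScalar r • hatF ξ)
  -- `θ'` commutes and associates with differential operators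
  | theta_comm (a : DiffOp A) : Relation g μ (opF a * thetaF) (thetaF * opF a)
  | theta_mul (a b : DiffOp A) : Relation g μ ((thetaF * opF a) * opF b) (thetaF * opF (a * b))
  | mul_theta (a b : DiffOp A) : Relation g μ (opF a * (thetaF * opF b)) (thetaF * opF (a * b))
  -- `f • ξ̂ = (f ξ)^ - (λ / 2μ) g^{ij} f_{,i} ξ_j θ'`
  | fn_hat (f : A) (ξ : Form A) : Relation g μ (opF (DiffOp.fn f) * hatF ξ)
      (hatF (f • ξ) - (lam * realScalar (1 / (2 * μ))) •
        (thetaF * opF (DiffOp.fn (g.coInner (dForm f) ξ))))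
  -- `ξ̂ • f = (f ξ)^ + (λ / 2μ) g^{ij} f_{,i} ξ_j θ'`
  | hat_fn (f : A) (ξ : Form A) : Relation g μ (hatF ξ * opF (DiffOp.fn f))
      (hatF (f • ξ) + (lam * realScalar (1 / (2 * μ))) •
        (thetaF * opF (DiffOp.fn (g.coInner (dForm f) ξ))))
  -- `[X, ξ̂] = λ (∇_X ξ)^ - (λ/μ) θ' (g^{ij} ξ_i ∇_j X)`
  -- `    - (λ²/2μ) θ' (X^a ξ_p g^{pq} R_{qa} + g^{ij} X^a_{;j} ξ_{i;a})`
  | vec_hat (X : Vec A) (ξ : Form A) : Relation g μ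
      (opF (DiffOp.vec X) * hatF ξ - hatF ξ * opF (DiffOp.vec X))
      (lam • hatF (g.leviCivita.nablaForm X ξ)
        - (lam * realScalar (1 / μ)) •
            (thetaF * opF (DiffOp.vec (g.leviCivita.nabla (g.sharp ξ) X)))
        - (lam ^ 2 * realScalar (1 / (2 * μ))) •
            (thetaF * opF (DiffOp.fn (g.ricci (g.sharp ξ) X + g.derivContraction X ξ))))

/-- The two-sided ideal generated by the relations. -/
def relIdeal (g : Metric A) (μ : ℝ) : Submodule Scalar (FreeCalc A) :=
  sInf {N | (∀ x y, Relation g μ x y → x - y ∈ N) ∧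
    ∀ n ∈ N, ∀ x : FreeCalc A, x * n ∈ N ∧ n * x ∈ N}

theorem mul_mem_relIdeal (g : Metric A) (μ : ℝ) {n : FreeCalc A} (hn : n ∈ relIdeal g μ)
    (x : FreeCalc A) : x * n ∈ relIdeal g μ ∧ n * x ∈ relIdeal g μ := by
  simp only [relIdeal, Submodule.mem_sInf] at hn ⊢
  exact ⟨fun N hN => (hN.2 n (hn N hN) x).1, fun N hN => (hN.2 n (hn N hN) x).2⟩

/-- The calculus: the (non-associative) algebra generated by the differential operators, the `ξ̂`
and `θ'`, with the above relations. Here `df` is `hat (dForm f)`. Differentials of vector fields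
would be further generators; they do not occur in the commutators of the ones here. -/
def Calc (g : Metric A) (μ : ℝ) : Type _ := FreeCalc A ⧸ relIdeal g μ

namespace Calc

variable {g : Metric A} {μ : ℝ}

instance : AddCommGroup (Calc g μ) := inferInstanceAs (AddCommGroup (FreeCalc A ⧸ relIdeal g μ))

instance : Module Scalar (Calc g μ) := inferInstanceAs (Module Scalar (FreeCalc A ⧸ relIdeal g μ))

/-- The quotient map. -/
def mk : FreeCalc A →ₗ[Scalar] Calc g μ := (relIdeal g μ).mkQ

/-- The product of the calculus, as a bilinear map. -/
def mulHom : Calc g μ →ₗ[Scalar] Calc g μ →ₗ[Scalar] Calc g μ :=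
  (relIdeal g μ).liftQ
    { toFun := fun x => (relIdeal g μ).mapQ (relIdeal g μ) (LinearMap.mulLeft Scalar x)
        (fun _ hn => (mul_mem_relIdeal g μ hn x).1)
      map_add' := fun x y => by
        refine Submodule.linearMap_qext _ (LinearMap.ext fun z => ?_)
        exact congrArg (relIdeal g μ).mkQ (add_mul x y z)
      map_smul' := fun k x => by
        refine Submodule.linearMap_qext _ (LinearMap.ext fun z => ?_)
        exact congrArg (relIdeal g μ).mkQ (smul_mul_assoc k x z) }
    (fun n hn => by
      refine Submodule.linearMap_qext _ (LinearMap.ext fun z => ?_)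
      exact (Submodule.Quotient.mk_eq_zero _).2 (mul_mem_relIdeal g μ hn z).2)

instance : Mul (Calc g μ) := ⟨fun x y => mulHom x y⟩

theorem mk_mul (x y : FreeCalc A) : (mk (x * y) : Calc g μ) = mk x * mk y := rfl

instance : NonUnitalNonAssocRing (Calc g μ) where
  left_distrib x y z := (mulHom x).map_add y z
  right_distrib x y z := LinearMap.congr_fun (mulHom.map_add x y) z
  zero_mul x := LinearMap.congr_fun mulHom.map_zero x
  mul_zero x := (mulHom x).map_zero

theorem mk_eq_of_relation {x y : FreeCalc A} (h : Relation g μ x y) :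
    (mk x : Calc g μ) = mk y := by
  refine (Submodule.Quotient.eq _).2 ?_
  simp only [relIdeal, Submodule.mem_sInf]
  exact fun N hN => hN.1 x y h

variable (g μ)

/-- A differential operator in the calculus. -/
def op (a : DiffOp A) : Calc g μ := mk (opF a)

/-- A function in the calculus. -/
def fn (f : A) : Calc g μ := op g μ (DiffOp.fn f)

/-- A vector field in the calculus. -/
def vec (X : Vec A) : Calc g μ := op g μ (DiffOp.vec X)

/-- The 1-form `ξ̂` of the calculus. -/
def hat (ξ : Form A) : Calc g μ := mk (hatF ξ)

/-- The central 1-form `θ'` of the calculus. -/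
def theta : Calc g μ := mk thetaF

variable {g μ}

/-- The commutator `[x, y] = x y - y x`. -/
def bracket (x y : Calc g μ) : Calc g μ := x * y - y * x

/-- The Jacobiator `J(x, y, z) = [x, [y, z]] + [z, [x, y]] + [y, [z, x]]`. -/
def jacobiator (x y z : Calc g μ) : Calc g μ :=
  bracket x (bracket y z) + bracket z (bracket x y) + bracket y (bracket z x)

end Calc

end Calculus

/-- Real smooth functions on a manifold modelled on `E`. -/
abbrev SmoothFn (E M : Type*) [NormedAddCommGroup E] [NormedSpace ℝ E] [TopologicalSpace M]
    [ChartedSpace E M] : Type _ := C^∞⟮𝓘(ℝ, E), M; ℝ⟯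

end DiffOpCalculus

end

open DiffOpCalculus DiffOpCalculus.Calc

/-! The argument is algebraic: it takes place over a commutative real algebra `A` whose derivations
and their `A`-dual play the vector fields and 1-forms.

Jacobiators. Expanding nested commutators by the defining relations leaves a part in `hat` and a
part in `theta`. For two functions every inner commutator is zero or `theta` times a function, and
these commute with functions. For `f`, `Y`, `ξ` the result is `λ²/μ` times `theta` times the torsion
of the pair `Y`, `ξ♯` applied to `f`, hence zero. For `Y`, `X`, `ξ` the `hat` part is the commutator
of covariant derivatives of `ξ`, which the Ricci identity turns into `ζ = ξ ∘ R(X,Y)`. In the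
`theta` part, torsion-freeness collects the vector fields into `R(Y,ξ♯)X + R(ξ♯,X)Y`; by the first
Bianchi identity this is `-R(X,Y)ξ♯`, and by skewness of `R(X,Y)` for the metric it is `ζ♯`. The
order `λ²` term of `[X, ξ̂]`, with Ricci and the second contraction, acquires a further factor `λ`
and disappears, so its form plays no role. See `jacobiator_vec_vec_hat`.

Non-vanishing. A quotient by generators and relations could collapse, so `λ²(ζ̂ - μ⁻¹ θ' ζ♯)` must
be seen to be nonzero when `ζ` is. The calculus maps to an explicit algebra where `theta` is zero
and `hat` is injective: operators on functions plus 1-forms, with vector fields acting on 1-forms by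
`λ∇`. Curvature prevents this from being an associative bimodule action, but the relations do not
ask for associativity there. The image `λ² ⊗ ζ` is nonzero. -/

noncomputable section

namespace DiffOpCalculus

/-! ### Identities for the Levi-Civita curvature, and expansions in a frame. -/

section Geometry

variable {A : Type*} [CommRing A] [Algebra ℝ A]

namespace Connection

variable (D : Connection A)

/-- `∇_X` as an additive endomorphism of vector fields. -/
def nablaRight (X : Vec A) : Vec A →+ Vec A := AddMonoidHom.mk' (D.nabla X) (D.add_right X)

/-- `X ↦ ∇_X Y` as a linear map, that is, the endomorphism `∇Y`. -/
def nablaLeft (Y : Vec A) : Vec A →ₗ[A] Vec A where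
  toFun X := D.nabla X Y
  map_add' X X' := D.add_left X X' Y
  map_smul' f X := D.smul_left f X Y

theorem nabla_sub_right (X Y Y' : Vec A) : D.nabla X (Y - Y') = D.nabla X Y - D.nabla X Y' :=
  map_sub (D.nablaRight X) Y Y'

theorem nabla_sub_left (X X' Y : Vec A) : D.nabla (X - X') Y = D.nabla X Y - D.nabla X' Y :=
  map_sub (D.nablaLeft Y) X X'

/-- The curvature as a linear map in its first argument. -/
def curvatureFst (Y Z : Vec A) : Vec A →ₗ[A] Vec A where
  toFun X := D.curvature X Y Z
  map_add' X X' := by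
    simp only [curvature, D.add_left, D.add_right, add_lie]
    abel
  map_smul' f X := by
    simp only [curvature, D.smul_left, D.leibniz, Metric.lie_smul_left, D.nabla_sub_left,
      RingHom.id_apply, smul_sub]
    abel

/-- The curvature as a linear map in its second argument. -/
def curvatureSnd (X Z : Vec A) : Vec A →ₗ[A] Vec A where
  toFun Y := D.curvature X Y Z
  map_add' Y Y' := by
    simp only [curvature, D.add_left, D.add_right, lie_add]
    abel
  map_smul' f Y := by
    simp only [curvature, D.smul_left, D.leibniz, Metric.lie_smul_right, D.add_left,
      RingHom.id_apply, smul_sub]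
    abel

/-- The Ricci identity for 1-forms. -/
theorem nablaForm_commutator (X Y : Vec A) (ξ : Form A) :
    D.nablaForm Y (D.nablaForm X ξ) - D.nablaForm X (D.nablaForm Y ξ)
      - D.nablaForm ⁅Y, X⁆ ξ = D.curvatureForm ξ X Y := by
  ext Z
  have h : D.nabla ⁅Y, X⁆ Z = -D.nabla ⁅X, Y⁆ Z := by
    rw [← lie_skew]
    exact map_neg (D.nablaLeft Z) _
  simp only [LinearMap.sub_apply]
  change Y (X (ξ Z) - ξ (D.nabla X Z)) - (X (ξ (D.nabla Y Z)) - ξ (D.nabla X (D.nabla Y Z)))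
    - (X (Y (ξ Z) - ξ (D.nabla Y Z)) - (Y (ξ (D.nabla X Z)) - ξ (D.nabla Y (D.nabla X Z))))
    - (⁅Y, X⁆ (ξ Z) - ξ (D.nabla ⁅Y, X⁆ Z)) = ξ (D.curvature X Y Z)
  simp only [h, curvature, map_sub, map_neg, Derivation.commutator_apply]
  ring

end Connection

namespace Metric

variable (g : Metric A)

/-- The musical isomorphism commutes with the Levi-Civita connection. -/
theorem sharp_nablaForm (X : Vec A) (ξ : Form A) :
    g.sharp (g.leviCivita.nablaForm X ξ) = g.leviCivita.nabla X (g.sharp ξ) := by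
  refine g.ext_inner fun Z => ?_
  rw [inner_sharp]
  change X (ξ Z) - ξ (g.leviCivita.nabla X Z) = _
  have h := g.leviCivita_metric X (g.sharp ξ) Z
  rw [inner_sharp, inner_sharp] at h
  rw [h]
  ring

theorem coInner_dForm (f : A) (ξ : Form A) : g.coInner (dForm f) ξ = g.sharp ξ f := rfl

theorem lie_eq_nabla (X Y : Vec A) :
    ⁅X, Y⁆ = g.leviCivita.nabla X Y - g.leviCivita.nabla Y X :=
  (g.leviCivita_torsion_free X Y).symm

/-- The first Bianchi identity. -/
theorem bianchi (X Y Z : Vec A) :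
    g.leviCivita.curvature X Y Z + g.leviCivita.curvature Y Z X
      + g.leviCivita.curvature Z X Y = 0 := by
  -- By torsion-freeness `[X,[Y,Z]] = ∇_X[Y,Z] - ∇_{[Y,Z]}X`, so the Jacobi identity of vector
  -- fields regroups into the cyclic sum of curvatures.
  have h := lie_jacobi X Y Z
  rw [g.lie_eq_nabla X, g.lie_eq_nabla Y ⁅Z, X⁆, g.lie_eq_nabla Z ⁅X, Y⁆] at h
  rw [← h, g.lie_eq_nabla Y Z, g.lie_eq_nabla Z X, g.lie_eq_nabla X Y]
  simp only [Connection.curvature, g.lie_eq_nabla Y Z, g.lie_eq_nabla Z X, g.lie_eq_nabla X Y,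
    Connection.nabla_sub_left, Connection.nabla_sub_right]
  abel

/-- The curvature of the Levi-Civita connection is skew for the metric. -/
theorem inner_curvature_skew (X Y Z W : Vec A) :
    g.inner (g.leviCivita.curvature X Y Z) W = -g.inner Z (g.leviCivita.curvature X Y W) := by
  -- Metric compatibility used twice. The two mixed terms are exchanged when `U` and `V` are
  -- swapped, so they cancel on antisymmetrising.
  have key : ∀ U V : Vec A, U (V (g.inner Z W)) =
      g.inner (g.leviCivita.nabla U (g.leviCivita.nabla V Z)) W
      + g.inner (g.leviCivita.nabla V Z) (g.leviCivita.nabla U W)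
      + (g.inner (g.leviCivita.nabla U Z) (g.leviCivita.nabla V W)
      + g.inner Z (g.leviCivita.nabla U (g.leviCivita.nabla V W))) := fun U V => by
    rw [g.leviCivita_metric V, map_add, g.leviCivita_metric U, g.leviCivita_metric U]
  have h := g.leviCivita_metric ⁅X, Y⁆ Z W
  rw [Derivation.commutator_apply, key, key] at h
  simp only [Connection.curvature, map_sub, LinearMap.sub_apply]
  linear_combination h

/-- Precomposing `ξ` with `R(X,Y)` is the transpose, and skewness for the metric makes the transpose
`-R(X,Y)` after raising the index. In this shape the Bianchi identity applies. -/
theorem sharp_curvatureForm (X Y : Vec A) (ξ : Form A) :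
    g.sharp (g.leviCivita.curvatureForm ξ X Y) = -g.leviCivita.curvature X Y (g.sharp ξ) := by
  refine g.ext_inner fun Z => ?_
  rw [inner_sharp, map_neg, LinearMap.neg_apply, inner_curvature_skew, neg_neg, inner_sharp]
  rfl

end Metric

namespace IsDualFrame

variable {n : ℕ} {e : Fin n → Vec A} {ε : Fin n → Form A}

theorem form_eq_sum (h : IsDualFrame e ε) (ξ : Form A) : ξ = ∑ i, ξ (e i) • ε i := by
  ext Z
  conv_lhs => rw [h Z]
  simp [LinearMap.sum_apply, mul_comm]

theorem sharp_eq_sum (h : IsDualFrame e ε) (g : Metric A) (ξ : Form A) :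
    g.sharp ξ = ∑ k, g.coInner (ε k) ξ • e k :=
  h (g.sharp ξ)

/-- Tensoriality in the first two slots, `curvatureFst` and `curvatureSnd`, allows `X` and `Y` to be
expanded. The third slot is covered by expanding the whole 1-form in the `ε j`. -/
theorem curvatureForm_eq_sum (h : IsDualFrame e ε) (D : Connection A) (ξ : Form A) (X Y : Vec A) :
    D.curvatureForm ξ X Y = ∑ a, ∑ c, ∑ i, ∑ j,
      (ε a Y * ε c X * ξ (e i) * ε i (D.curvature (e c) (e a) (e j))) • ε j := by
  have hX : ∀ Z, D.curvature X Y Z = ∑ a, ∑ c, (ε a Y * ε c X) • D.curvature (e c) (e a) Z := by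
    intro Z
    have h1 : D.curvature X Y Z = ∑ a, ε a Y • D.curvature X (e a) Z := by
      have := congrArg (D.curvatureSnd X Z) (h Y)
      simp only [map_sum, map_smul] at this
      exact this
    have h2 : ∀ a, D.curvature X (e a) Z = ∑ c, ε c X • D.curvature (e c) (e a) Z := by
      intro a
      have := congrArg (D.curvatureFst (e a) Z) (h X)
      simp only [map_sum, map_smul] at this
      exact this
    rw [h1]
    simp only [h2, Finset.smul_sum, smul_smul]
  conv_lhs => rw [h.form_eq_sum (D.curvatureForm ξ X Y)]
  have hj : ∀ j, D.curvatureForm ξ X Y (e j) = ∑ a, ∑ c, ∑ i,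
      ε a Y * ε c X * ξ (e i) * ε i (D.curvature (e c) (e a) (e j)) := by
    intro j
    change ξ (D.curvature X Y (e j)) = _
    rw [hX, map_sum]
    refine Finset.sum_congr rfl fun a _ => ?_
    rw [map_sum]
    refine Finset.sum_congr rfl fun c _ => ?_
    conv_lhs => rw [h (D.curvature (e c) (e a) (e j))]
    rw [map_smul, map_sum, smul_eq_mul, Finset.mul_sum]
    refine Finset.sum_congr rfl fun i _ => ?_
    rw [map_smul, smul_eq_mul]
    ring
  simp only [hj, Finset.sum_smul]
  rw [Finset.sum_comm]
  refine Finset.sum_congr rfl fun a _ => ?_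
  rw [Finset.sum_comm]
  refine Finset.sum_congr rfl fun c _ => ?_
  rw [Finset.sum_comm]

end IsDualFrame

end Geometry

end DiffOpCalculus

/-! ### Commutators in the calculus and the three Jacobiators. -/

namespace DiffOpCalculus

theorem lam_pow_three : lam ^ 3 = 0 := by
  have h := AdjoinRoot.mk_self (f := (Polynomial.X ^ 3 : Polynomial ℂ))
  rwa [map_pow, AdjoinRoot.mk_X] at h

section Jacobi

variable {A : Type*} [CommRing A] [Algebra ℝ A]

namespace DiffOp

theorem fn_mul (f h : A) : fn (f * h) = fn f * fn h :=
  (RingQuot.mkAlgHom_rel Scalar (DiffOpRel.fn_mul f h)).trans (map_mul _ _ _)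

theorem vec_add (X Y : Vec A) : vec (X + Y) = vec X + vec Y :=
  (RingQuot.mkAlgHom_rel Scalar (DiffOpRel.vec_add X Y)).trans (map_add _ _ _)

theorem vec_smul (f : A) (X : Vec A) : vec (f • X) = fn f * vec X :=
  (RingQuot.mkAlgHom_rel Scalar (DiffOpRel.fn_vec f X)).trans (map_mul _ _ _)

theorem vec_fn_commutator (X : Vec A) (f : A) :
    vec X * fn f - fn f * vec X = lam • fn (X f) := by
  have h := RingQuot.mkAlgHom_rel Scalar (DiffOpRel.vec_fn X f)
  rwa [map_sub, map_mul, map_mul, map_smul] at h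

theorem vec_vec_commutator (Y X : Vec A) :
    vec Y * vec X - vec X * vec Y = lam • vec ⁅Y, X⁆ := by
  have h := RingQuot.mkAlgHom_rel Scalar (DiffOpRel.vec_vec Y X)
  rwa [map_sub, map_mul, map_mul, map_smul] at h

theorem fn_fn_commutator (f h : A) : fn f * fn h - fn h * fn f = 0 := by
  rw [← fn_mul, ← fn_mul, mul_comm, sub_self]

theorem fn_add (f h : A) : fn (f + h) = fn f + fn h :=
  (RingQuot.mkAlgHom_rel Scalar (DiffOpRel.fn_add f h)).trans (map_add _ _ _)

end DiffOp

namespace Calc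

variable {g : Metric A} {μ : ℝ}

instance : IsScalarTower Scalar (Calc g μ) (Calc g μ) where
  smul_assoc k x y := LinearMap.congr_fun (mulHom.map_smul k x) y

instance : SMulCommClass Scalar (Calc g μ) (Calc g μ) where
  smul_comm k x y := ((mulHom x).map_smul k y).symm

theorem bracket_sub_right (x y z : Calc g μ) : bracket x (y - z) = bracket x y - bracket x z := by
  simp only [bracket, mul_sub, sub_mul]
  abel

theorem bracket_smul_right (k : Scalar) (x y : Calc g μ) :
    bracket x (k • y) = k • bracket x y := by
  simp only [bracket, mul_smul_comm, smul_mul_assoc, smul_sub]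

theorem bracket_zero_right (x : Calc g μ) : bracket x 0 = 0 := by
  simp [bracket]

theorem bracket_neg_right (x y : Calc g μ) : bracket x (-y) = -bracket x y := by
  simp only [bracket, mul_neg, neg_mul]
  abel

theorem bracket_swap (x y : Calc g μ) : bracket y x = -bracket x y := by
  simp [bracket]

theorem op_add (a b : DiffOp A) : op g μ (a + b) = op g μ a + op g μ b :=
  (mk_eq_of_relation (Relation.op_add a b)).trans (map_add _ _ _)

theorem op_smul (k : Scalar) (a : DiffOp A) : op g μ (k • a) = k • op g μ a :=
  (mk_eq_of_relation (Relation.op_smul k a)).trans (map_smul _ _ _)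

theorem op_mul (a b : DiffOp A) : op g μ (a * b) = op g μ a * op g μ b :=
  mk_eq_of_relation (Relation.op_mul a b)

variable (g μ) in
/-- The inclusion of the differential operators, as a linear map. -/
def opHom : DiffOp A →ₗ[Scalar] Calc g μ where
  toFun := op g μ
  map_add' := op_add
  map_smul' := op_smul

theorem op_sub (a b : DiffOp A) : op g μ (a - b) = op g μ a - op g μ b :=
  map_sub (opHom g μ) a b

theorem op_zero : op g μ 0 = 0 :=
  map_zero (opHom g μ)

variable (g μ) in
/-- `ξ ↦ ξ̂` as an additive map. -/
def hatHom : Form A →+ Calc g μ :=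
  AddMonoidHom.mk' (hat g μ) fun ξ η =>
    (mk_eq_of_relation (Relation.hat_add ξ η)).trans (map_add _ _ _)

variable (g μ) in
/-- `X ↦ θ' X` as an additive map. -/
def thetaVecHom : Vec A →+ Calc g μ :=
  AddMonoidHom.mk' (fun X => theta g μ * vec g μ X) fun X Y => by
    rw [vec, DiffOp.vec_add, op_add, mul_add]
    rfl

variable (g μ) in
/-- `f ↦ θ' f` as an additive map. -/
def thetaFnHom : A →+ Calc g μ :=
  AddMonoidHom.mk' (fun f => theta g μ * fn g μ f) fun f h => by
    rw [fn, DiffOp.fn_add, op_add, mul_add]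
    rfl

theorem op_mul_theta_mul (a b : DiffOp A) :
    op g μ a * (theta g μ * op g μ b) = theta g μ * op g μ (a * b) :=
  mk_eq_of_relation (Relation.mul_theta a b)

theorem theta_mul_mul_op (a b : DiffOp A) :
    (theta g μ * op g μ a) * op g μ b = theta g μ * op g μ (a * b) :=
  mk_eq_of_relation (Relation.theta_mul a b)

theorem bracket_op_op (a b : DiffOp A) :
    bracket (op g μ a) (op g μ b) = op g μ (a * b - b * a) := by
  rw [bracket, op_sub, op_mul, op_mul]

/-- `theta` passes through operators on both sides, so the commutator is computed inside the
associative algebra of differential operators. -/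
theorem bracket_op_theta (a b : DiffOp A) :
    bracket (op g μ a) (theta g μ * op g μ b) = theta g μ * op g μ (a * b - b * a) := by
  rw [bracket, op_mul_theta_mul, theta_mul_mul_op, ← mul_sub, op_sub]

theorem bracket_fn_fn (f h : A) : bracket (fn g μ f) (fn g μ h) = 0 := by
  rw [fn, fn, bracket_op_op, DiffOp.fn_fn_commutator, op_zero]

theorem bracket_fn_vec (f : A) (X : Vec A) :
    bracket (fn g μ f) (vec g μ X) = -(lam • fn g μ (X f)) := by
  rw [bracket_swap, vec, fn, bracket_op_op, DiffOp.vec_fn_commutator, op_smul]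
  rfl

theorem bracket_vec_vec (Y X : Vec A) :
    bracket (vec g μ Y) (vec g μ X) = lam • vec g μ ⁅Y, X⁆ := by
  rw [vec, vec, bracket_op_op, DiffOp.vec_vec_commutator, op_smul]
  rfl

theorem bracket_fn_thetaFn (f h : A) :
    bracket (fn g μ f) (thetaFnHom g μ h) = 0 := by
  change bracket (op g μ _) (theta g μ * op g μ _) = 0
  rw [bracket_op_theta, DiffOp.fn_fn_commutator, op_zero, mul_zero]

theorem bracket_vec_thetaFn (X : Vec A) (f : A) :
    bracket (vec g μ X) (thetaFnHom g μ f) = lam • thetaFnHom g μ (X f) := by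
  change bracket (op g μ _) (theta g μ * op g μ _) = _
  rw [bracket_op_theta, DiffOp.vec_fn_commutator, op_smul, mul_smul_comm]
  rfl

theorem bracket_fn_thetaVec (f : A) (X : Vec A) :
    bracket (fn g μ f) (thetaVecHom g μ X) = -(lam • thetaFnHom g μ (X f)) := by
  change bracket (op g μ _) (theta g μ * op g μ _) = _
  rw [bracket_op_theta, ← neg_sub, DiffOp.vec_fn_commutator, ← neg_one_smul Scalar, op_smul,
    op_smul, mul_smul_comm, mul_smul_comm, neg_one_smul]
  rfl

theorem bracket_vec_thetaVec (Y X : Vec A) :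
    bracket (vec g μ Y) (thetaVecHom g μ X) = lam • thetaVecHom g μ ⁅Y, X⁆ := by
  change bracket (op g μ _) (theta g μ * op g μ _) = _
  rw [bracket_op_theta, DiffOp.vec_vec_commutator, op_smul, mul_smul_comm]
  rfl

theorem fn_mul_hat (f : A) (ξ : Form A) :
    fn g μ f * hat g μ ξ = hatHom g μ (f • ξ)
      - (lam * realScalar (1 / (2 * μ))) • thetaFnHom g μ (g.coInner (dForm f) ξ) :=
  (mk_eq_of_relation (Relation.fn_hat f ξ)).trans <| by rw [map_sub, map_smul]; rfl

theorem hat_mul_fn (f : A) (ξ : Form A) :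
    hat g μ ξ * fn g μ f = hatHom g μ (f • ξ)
      + (lam * realScalar (1 / (2 * μ))) • thetaFnHom g μ (g.coInner (dForm f) ξ) :=
  (mk_eq_of_relation (Relation.hat_fn f ξ)).trans <| by rw [map_add, map_smul]; rfl

/-- The classical parts of the left and right products agree and cancel; their corrections have
opposite signs, so the two halves `1/(2μ)` add up to `1/μ`. -/
theorem bracket_fn_hat (f : A) (ξ : Form A) :
    bracket (fn g μ f) (hat g μ ξ) =
      -((lam * realScalar (1 / μ)) • thetaFnHom g μ (g.sharp ξ f)) := by
  have h : realScalar (1 / μ) = realScalar (1 / (2 * μ)) + realScalar (1 / (2 * μ)) := by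
    rw [← map_add]
    congr 1
    rw [one_div, one_div, mul_inv]
    ring
  rw [bracket, fn_mul_hat, hat_mul_fn, h, mul_add, add_smul, g.coInner_dForm]
  abel

theorem bracket_vec_hat (X : Vec A) (ξ : Form A) :
    bracket (vec g μ X) (hat g μ ξ) = lam • hatHom g μ (g.leviCivita.nablaForm X ξ)
      - (lam * realScalar (1 / μ)) • thetaVecHom g μ (g.leviCivita.nabla (g.sharp ξ) X)
      - (lam ^ 2 * realScalar (1 / (2 * μ))) •
          thetaFnHom g μ (g.ricci (g.sharp ξ) X + g.derivContraction X ξ) := by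
  have h := mk_eq_of_relation (Relation.vec_hat (g := g) (μ := μ) X ξ)
  simp only [map_sub, map_smul] at h
  exact h

theorem jacobiator_fn_fn_hat (f h : A) (ξ : Form A) :
    jacobiator (fn g μ f) (fn g μ h) (hat g μ ξ) = 0 := by
  rw [jacobiator, bracket_fn_fn, bracket_swap (fn g μ f) (hat g μ ξ), bracket_fn_hat,
    bracket_fn_hat]
  simp [bracket_neg_right, bracket_smul_right, bracket_fn_thetaFn, bracket_zero_right]

/-- The order `λ²` term of `[Y, ξ̂]` is `theta` times a function and commutes with `f`. What remains
is the torsion of `Y` and `ξ♯` acting on `f`. -/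
theorem jacobiator_fn_vec_hat (f : A) (Y : Vec A) (ξ : Form A) :
    jacobiator (fn g μ f) (vec g μ Y) (hat g μ ξ) = 0 := by
  have hf : ∀ η : Form A, bracket (fn g μ f) (hatHom g μ η) = _ := bracket_fn_hat f
  -- This is `[Y,ξ♯] = ∇_Y ξ♯ - ∇_{ξ♯} Y` evaluated on `f`, using that `♯` commutes with `∇_Y`.
  have key : -g.sharp (g.leviCivita.nablaForm Y ξ) f
      + (g.leviCivita.nabla (g.sharp ξ) Y) f - (g.sharp ξ) (Y f) + Y (g.sharp ξ f) = 0 := by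
    rw [g.sharp_nablaForm]
    have := congrArg (fun Z : Vec A => Z f) (g.lie_eq_nabla Y (g.sharp ξ))
    simp only [Derivation.commutator_apply, Derivation.sub_apply] at this
    linear_combination this
  have h : jacobiator (fn g μ f) (vec g μ Y) (hat g μ ξ) =
      (lam ^ 2 * realScalar (1 / μ)) • thetaFnHom g μ
        (-g.sharp (g.leviCivita.nablaForm Y ξ) f
          + (g.leviCivita.nabla (g.sharp ξ) Y) f - (g.sharp ξ) (Y f) + Y (g.sharp ξ f)) := by
    rw [jacobiator, bracket_swap (fn g μ f) (hat g μ ξ), bracket_fn_hat, bracket_fn_vec,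
      bracket_vec_hat, bracket_sub_right, bracket_sub_right, neg_neg]
    simp only [bracket_neg_right, bracket_smul_right, bracket_fn_thetaFn, hf,
      bracket_fn_thetaVec, bracket_vec_thetaFn, bracket_swap (fn g μ (Y f)) (hat g μ ξ),
      bracket_fn_hat]
    simp only [map_add, map_sub, map_neg]
    module
  rw [h, key, map_zero, smul_zero]

/-- The Ricci identity gives the `hat` part; Bianchi together with skewness identifies the `theta`
part with the raised version of the same 1-form. -/
theorem jacobiator_vec_vec_hat (X Y : Vec A) (ξ : Form A) :
    jacobiator (vec g μ Y) (vec g μ X) (hat g μ ξ) =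
      lam ^ 2 • (hatHom g μ (g.leviCivita.curvatureForm ξ X Y)
        - realScalar μ⁻¹ • thetaVecHom g μ (g.sharp (g.leviCivita.curvatureForm ξ X Y))) := by
  have hv : ∀ (Z : Vec A) (η : Form A), bracket (vec g μ Z) (hatHom g μ η) = _ := bracket_vec_hat
  -- The right side is the combination of vector fields that multiplies `-(λ²/μ) θ'` in the expanded
  -- Jacobiator.
  have hsharp : g.sharp (g.leviCivita.curvatureForm ξ X Y)
      = g.leviCivita.nabla (g.sharp (g.leviCivita.nablaForm X ξ)) Y
        + ⁅Y, g.leviCivita.nabla (g.sharp ξ) X⁆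
        - g.leviCivita.nabla (g.sharp (g.leviCivita.nablaForm Y ξ)) X
        - ⁅X, g.leviCivita.nabla (g.sharp ξ) Y⁆ - g.leviCivita.nabla (g.sharp ξ) ⁅Y, X⁆ := by
    have hB := g.bianchi X Y (g.sharp ξ)
    -- Bianchi: `-R(X,Y)ξ♯ = R(Y,ξ♯)X + R(ξ♯,X)Y`.
    rw [g.sharp_curvatureForm, neg_eq_of_add_eq_zero_right ((add_assoc _ _ _).symm.trans hB),
      g.sharp_nablaForm, g.sharp_nablaForm]
    simp only [Connection.curvature, g.lie_eq_nabla, Connection.nabla_sub_left,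
      Connection.nabla_sub_right]
    abel
  -- Every contribution of the Ricci and contraction term to the Jacobiator has a coefficient of
  -- this kind.
  have h3 : ∀ k : Scalar, lam * (lam ^ 2 * k) = 0 := fun k => by
    rw [← mul_assoc, ← pow_succ', lam_pow_three, zero_mul]
  have h3_right : ∀ k : Scalar, lam ^ 2 * k * lam = 0 := fun k => by rw [mul_comm, h3]
  rw [← g.leviCivita.nablaForm_commutator X Y ξ] at hsharp ⊢
  rw [hsharp, jacobiator, bracket_vec_vec, bracket_smul_right,
    bracket_swap (vec g μ Y) (hat g μ ξ), bracket_swap (vec g μ ⁅Y, X⁆) (hat g μ ξ),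
    bracket_vec_hat, bracket_vec_hat, bracket_vec_hat]
  simp only [bracket_neg_right, bracket_sub_right, bracket_smul_right, bracket_vec_thetaFn, hv,
    bracket_vec_thetaVec, smul_neg, smul_sub, smul_smul, h3, h3_right, zero_smul,
    sub_zero]
  simp only [map_add, map_sub, ← one_div]
  module

/-- After multiplication by `λ²` the product of a function with `ξ̂` is classical, since its
correction has order `λ`. Hence coefficients may be taken out of `hat`. -/
theorem jacobiator_vec_vec_hat_frame {n : ℕ} {e : Fin n → Vec A} {ε : Fin n → Form A}
    (h : IsDualFrame e ε) (X Y : Vec A) (ξ : Form A) :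
    jacobiator (vec g μ Y) (vec g μ X) (hat g μ ξ) =
      lam ^ 2 • ∑ a, ∑ c, ∑ i, ∑ j,
        fn g μ (ε a Y * ε c X * ξ (e i) * ε i (g.leviCivita.curvature (e c) (e a) (e j))) *
          (hat g μ (ε j) - realScalar μ⁻¹ •
            ∑ k, theta g μ * (fn g μ (g.coInner (ε k) (ε j)) * vec g μ (e k))) := by
  -- `F η = λ²(η̂ - μ⁻¹ θ' η♯)`, packaged as an additive map so that it passes through the frame
  -- expansion of the curvature form.
  let F : Form A →+ Calc g μ := (DistribSMul.toAddMonoidHom _ (lam ^ 2)).comp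
    (hatHom g μ - (DistribSMul.toAddMonoidHom _ (realScalar μ⁻¹)).comp
      ((thetaVecHom g μ).comp g.sharp.toLinearMap.toAddMonoidHom))
  have hk : ∀ (f : A) (Z : Vec A), fn g μ f * vec g μ Z = vec g μ (f • Z) := fun f Z => by
    rw [vec, vec, DiffOp.vec_smul, op_mul]
    rfl
  have hθ : ∀ (f : A) (Z : Vec A), fn g μ f * thetaVecHom g μ Z = thetaVecHom g μ (f • Z) :=
    fun f Z => by
      change op g μ _ * (theta g μ * op g μ _) = _
      rw [op_mul_theta_mul, ← DiffOp.vec_smul]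
      rfl
  have hF : ∀ (c : A) (j : Fin n), F (c • ε j) = lam ^ 2 • (fn g μ c *
      (hat g μ (ε j) - realScalar μ⁻¹ •
        ∑ k, theta g μ * (fn g μ (g.coInner (ε k) (ε j)) * vec g μ (e k)))) := by
    intro c j
    have hs : ∑ k, theta g μ * (fn g μ (g.coInner (ε k) (ε j)) * vec g μ (e k))
        = thetaVecHom g μ (g.sharp (ε j)) := by
      rw [h.sharp_eq_sum g (ε j), map_sum]
      exact Finset.sum_congr rfl fun k _ => by rw [hk]; rfl
    have h3 : ∀ k : Scalar, lam ^ 2 * (lam * k) = 0 := fun k => by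
      rw [← mul_assoc, ← pow_succ, lam_pow_three, zero_mul]
    rw [hs, mul_sub, fn_mul_hat, mul_smul_comm, hθ, smul_sub, smul_sub, smul_smul _ _
      (thetaFnHom g μ _), h3, zero_smul, sub_zero, ← smul_sub, ← g.sharp.map_smul]
    rfl
  rw [jacobiator_vec_vec_hat]
  change F _ = _
  rw [h.curvatureForm_eq_sum]
  simp only [map_sum, hF, Finset.smul_sum]

end Calc

end Jacobi

end DiffOpCalculus

/-! ### A concrete non-associative algebra of operators and 1-forms. -/

namespace DiffOpCalculus

section Model

open scoped TensorProduct

variable (A : Type*) [CommRing A] [Algebra ℝ A]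

/-- The first order differential operators `f + X` on functions. -/
def firstOrder : (A × Vec A) →ₗ[ℝ] Module.End ℝ A where
  toFun p := LinearMap.mulLeft ℝ p.1 + (p.2 : A →ₗ[ℝ] A)
  map_add' p q := by
    ext a
    simp
    ring
  map_smul' r p := by
    ext a
    simp

theorem firstOrder_apply (p : A × Vec A) (a : A) : firstOrder A p a = p.1 * a + p.2 a := rfl

/-- Derivations kill `1`, so `f + X` determines `f` by its value at `1`, and then `X`. Only the
action of first order operators on 1-forms is prescribed by the relations; an arbitrary real-linear
projection extends it to all operators. -/
theorem exists_symbol : ∃ s : Module.End ℝ A →ₗ[ℝ] A × Vec A,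
    s ∘ₗ firstOrder A = LinearMap.id := by
  refine LinearMap.exists_leftInverse_of_injective _ (LinearMap.ker_eq_bot'.2 fun p hp => ?_)
  have h1 : p.1 = 0 := by simpa [firstOrder_apply] using LinearMap.congr_fun hp 1
  refine Prod.ext h1 (Derivation.ext fun a => ?_)
  simpa [firstOrder_apply, h1] using LinearMap.congr_fun hp a

/-- A linear projection of the operators on functions to the first order ones. -/
def symbol : Module.End ℝ A →ₗ[ℝ] A × Vec A := (exists_symbol A).choose

variable {A}

theorem symbol_firstOrder (p : A × Vec A) : symbol A (firstOrder A p) = p :=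
  LinearMap.congr_fun (exists_symbol A).choose_spec p

/-- The action of first order operators on 1-forms by covariant differentiation. -/
def Connection.formAction (D : Connection A) : (A × Vec A) →ₗ[ℝ] Module.End ℝ (Form A) where
  toFun p :=
    { toFun := fun ξ => p.1 • ξ + D.nablaForm p.2 ξ
      map_add' := fun ξ η => by
        ext Z
        change p.1 * (ξ Z + η Z) + (p.2 (ξ Z + η Z) - (ξ (D.nabla p.2 Z) + η (D.nabla p.2 Z))) =
          p.1 * ξ Z + (p.2 (ξ Z) - ξ (D.nabla p.2 Z))
            + (p.1 * η Z + (p.2 (η Z) - η (D.nabla p.2 Z)))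
        rw [map_add]
        ring
      map_smul' := fun r ξ => by
        ext Z
        change p.1 * (r • ξ Z) + (p.2 (r • ξ Z) - r • ξ (D.nabla p.2 Z)) =
          r • (p.1 * ξ Z + (p.2 (ξ Z) - ξ (D.nabla p.2 Z)))
        simp only [Derivation.map_smul, smul_add, smul_sub, mul_smul_comm] }
  map_add' p q := by
    ext ξ Z
    change (p.1 + q.1) * ξ Z + (p.2 (ξ Z) + q.2 (ξ Z) - ξ (D.nabla (p.2 + q.2) Z)) =
      p.1 * ξ Z + (p.2 (ξ Z) - ξ (D.nabla p.2 Z)) + (q.1 * ξ Z + (q.2 (ξ Z) - ξ (D.nabla q.2 Z)))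
    rw [D.add_left, map_add]
    ring
  map_smul' r p := by
    ext ξ Z
    change (r • p.1) * ξ Z + (r • p.2 (ξ Z) - ξ (D.nabla (r • p.2) Z)) =
      r • (p.1 * ξ Z + (p.2 (ξ Z) - ξ (D.nabla p.2 Z)))
    rw [← algebraMap_smul A r p.2, D.smul_left, map_smul, algebraMap_smul]
    simp only [smul_add, smul_sub, smul_mul_assoc]

variable (K : Type*) [CommRing K] [Algebra ℝ K]

/-- Scalar extension of a linear family of operators. -/
def extendAction {V W : Type*} [AddCommGroup V] [Module ℝ V] [AddCommGroup W] [Module ℝ W]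
    (T : W →ₗ[ℝ] Module.End ℝ V) : K ⊗[ℝ] W →ₗ[K] Module.End K (K ⊗[ℝ] V) :=
  LinearMap.liftBaseChange K ((LinearMap.baseChangeHom ℝ K V V).comp T)

theorem extendAction_tmul {V W : Type*} [AddCommGroup V] [Module ℝ V] [AddCommGroup W]
    [Module ℝ W] (T : W →ₗ[ℝ] Module.End ℝ V) (k l : K) (w : W) (v : V) :
    extendAction K T (k ⊗ₜ w) (l ⊗ₜ v) = (k * l) ⊗ₜ T w v := by
  simp [extendAction, TensorProduct.smul_tmul']

/-- Over the field `ℝ` a linear functional detects `v`; applying it to the second factor leaves a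
nonzero real multiple of `k`. -/
theorem tmul_ne_zero {V : Type*} [AddCommGroup V] [Module ℝ V] {k : K} {v : V} (hk : k ≠ 0)
    (hv : v ≠ 0) : k ⊗ₜ[ℝ] v ≠ 0 := by
  obtain ⟨f, hf⟩ : ∃ f : Module.Dual ℝ V, f v ≠ 0 := by
    by_contra! h
    exact hv ((Module.forall_dual_apply_eq_zero_iff ℝ v).1 h)
  intro h
  have h2 := congrArg (fun t => TensorProduct.rid ℝ K (f.lTensor K t)) h
  simp only [LinearMap.lTensor_tmul, TensorProduct.rid_tmul, map_zero] at h2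
  exact (smul_ne_zero hf hk) h2

variable (A) in
/-- The operators on functions, with scalars extended to `K`. -/
def ExtOp : Type _ := K ⊗[ℝ] Module.End ℝ A

instance : Ring (ExtOp A K) := inferInstanceAs (Ring (K ⊗[ℝ] Module.End ℝ A))

instance : Algebra K (ExtOp A K) := inferInstanceAs (Algebra K (K ⊗[ℝ] Module.End ℝ A))

namespace ExtOp

variable {K}

/-- The multiple by `k` of the first order operator `f + X`. -/
def first (k : K) (f : A) (X : Vec A) : ExtOp A K := k ⊗ₜ firstOrder A (f, X)

theorem first_add (k : K) (f h : A) (X Y : Vec A) :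
    first k (f + h) (X + Y) = first k f X + first k h Y :=
  (congrArg (k ⊗ₜ[ℝ] ·) (map_add (firstOrder A) (f, X) (h, Y))).trans
    (TensorProduct.tmul_add _ _ _)

theorem first_mul_first (k l : K) (f h : A) (X Y : Vec A) :
    first k f X * first l h Y =
      ((k * l) ⊗ₜ (firstOrder A (f, X) * firstOrder A (h, Y)) : K ⊗[ℝ] Module.End ℝ A) :=
  Algebra.TensorProduct.tmul_mul_tmul _ _ _ _

theorem smul_first (c k : K) (f : A) (X : Vec A) : c • first k f X = first (c * k) f X :=
  TensorProduct.smul_tmul' _ _ _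

theorem first_algebraMap (r : ℝ) :
    first 1 (algebraMap ℝ A r) 0 = algebraMap K (ExtOp A K) (algebraMap ℝ K r) := by
  change (1 : K) ⊗ₜ firstOrder A (algebraMap ℝ A r, 0) = algebraMap ℝ K r ⊗ₜ 1
  rw [Algebra.algebraMap_eq_smul_one (A := K), TensorProduct.smul_tmul]
  congr 1
  ext a
  simp [firstOrder_apply, Algebra.smul_def]

theorem first_one : first (1 : K) (1 : A) 0 = 1 := by
  have h := first_algebraMap (A := A) (K := K) 1
  rwa [map_one, map_one, map_one] at h

theorem first_mul (f h : A) : first (1 : K) (f * h) 0 = first 1 f 0 * first 1 h 0 := by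
  rw [first_mul_first, one_mul]
  change (1 : K) ⊗ₜ firstOrder A (f * h, 0) = _
  congr 1
  ext a
  simp [firstOrder_apply, mul_assoc]

theorem first_smul (l : K) (f : A) (X : Vec A) :
    first l 0 (f • X) = first 1 f 0 * first l 0 X := by
  rw [first_mul_first, one_mul]
  change l ⊗ₜ firstOrder A (0, f • X) = _
  congr 1
  ext a
  simp [firstOrder_apply]

theorem vec_fn_commutator (l : K) (X : Vec A) (f : A) :
    first l 0 X * first 1 f 0 - first 1 f 0 * first l 0 X = l • first 1 (X f) 0 := by
  rw [first_mul_first, first_mul_first, smul_first, one_mul, mul_one]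
  refine (TensorProduct.tmul_sub _ _ _).symm.trans (congrArg (l ⊗ₜ[ℝ] ·) ?_)
  ext a
  simp [firstOrder_apply, mul_comm]

theorem vec_vec_commutator (l : K) (Y X : Vec A) :
    first l 0 Y * first l 0 X - first l 0 X * first l 0 Y = l • first l 0 ⁅Y, X⁆ := by
  rw [first_mul_first, first_mul_first, smul_first]
  refine (TensorProduct.tmul_sub _ _ _).symm.trans (congrArg ((l * l) ⊗ₜ[ℝ] ·) ?_)
  ext a
  simp [firstOrder_apply, Derivation.commutator_apply]

end ExtOp

/-- Operators on functions together with 1-forms, with scalars extended to `K`: the underlying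
module of an algebra in which operators multiply 1-forms from both sides. -/
def FormModel (K : Type*) [CommRing K] [Algebra ℝ K] (_D : Connection A) : Type _ :=
  ExtOp A K × (K ⊗[ℝ] Form A)

namespace FormModel

variable {K} {D : Connection A}

instance : AddCommGroup (FormModel K D) :=
  inferInstanceAs (AddCommGroup (ExtOp A K × (K ⊗[ℝ] Form A)))

instance : Module K (FormModel K D) :=
  inferInstanceAs (Module K (ExtOp A K × (K ⊗[ℝ] Form A)))

/-- Left multiplication of 1-forms by operators: first order ones act by the connection. -/
def left (D : Connection A) : ExtOp A K →ₗ[K] Module.End K (K ⊗[ℝ] Form A) :=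
  extendAction K (D.formAction.comp (symbol A))

/-- Right multiplication of 1-forms by operators, through their values on the constant `1`. -/
def right : ExtOp A K →ₗ[K] Module.End K (K ⊗[ℝ] Form A) :=
  extendAction K ((Algebra.lsmul ℝ ℝ (Form A)).toLinearMap.comp (LinearMap.applyₗ (1 : A)))

theorem left_first (k l : K) (f : A) (X : Vec A) (ξ : Form A) :
    left D (ExtOp.first k f X) (l ⊗ₜ ξ) = (k * l) ⊗ₜ (f • ξ + D.nablaForm X ξ) := by
  refine (extendAction_tmul K _ k l _ ξ).trans ?_
  rw [LinearMap.comp_apply, symbol_firstOrder]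
  rfl

theorem right_first (k l : K) (f : A) (X : Vec A) (ξ : Form A) :
    right (ExtOp.first k f X) (l ⊗ₜ ξ) = (k * l) ⊗ₜ (f • ξ) := by
  refine (extendAction_tmul K _ k l _ ξ).trans ?_
  have h : firstOrder A (f, X) 1 = f := by simp [firstOrder_apply]
  change (k * l) ⊗ₜ (firstOrder A (f, X) 1 • ξ) = _
  rw [h]

/-- A square-zero extension of the operators by the 1-forms. The maps `left` and `right` are only
required to be linear and unital, not multiplicative, which leaves room for curvature. -/
instance : Mul (FormModel K D) :=
  ⟨fun x y => (x.1 * y.1, left D x.1 y.2 + right y.1 x.2)⟩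

instance : NonUnitalNonAssocRing (FormModel K D) where
  left_distrib x y z := by
    refine Prod.ext (mul_add x.1 y.1 z.1) ?_
    change left D x.1 (y.2 + z.2) + right (y.1 + z.1) x.2 =
      left D x.1 y.2 + right y.1 x.2 + (left D x.1 z.2 + right z.1 x.2)
    rw [map_add, map_add, LinearMap.add_apply]
    abel
  right_distrib x y z := by
    refine Prod.ext (add_mul x.1 y.1 z.1) ?_
    change left D (x.1 + y.1) z.2 + right z.1 (x.2 + y.2) =
      left D x.1 z.2 + right z.1 x.2 + (left D y.1 z.2 + right z.1 y.2)
    rw [map_add, map_add, LinearMap.add_apply]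
    abel
  zero_mul x := by
    refine Prod.ext (zero_mul x.1) ?_
    change left D 0 x.2 + right x.1 0 = 0
    rw [map_zero, map_zero, LinearMap.zero_apply, add_zero]
  mul_zero x := by
    refine Prod.ext (mul_zero x.1) ?_
    change left D x.1 0 + right 0 x.2 = 0
    rw [map_zero, map_zero, LinearMap.zero_apply, add_zero]

instance : IsScalarTower K (FormModel K D) (FormModel K D) where
  smul_assoc k x y := by
    refine Prod.ext (smul_mul_assoc k x.1 y.1) ?_
    change left D (k • x.1) y.2 + right y.1 (k • x.2) = k • (left D x.1 y.2 + right y.1 x.2)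
    rw [map_smul, map_smul, LinearMap.smul_apply, smul_add]

instance : SMulCommClass K (FormModel K D) (FormModel K D) where
  smul_comm k x y := by
    refine Prod.ext (mul_smul_comm k x.1 y.1).symm ?_
    change k • (left D x.1 y.2 + right y.1 x.2) = left D x.1 (k • y.2) + right (k • y.1) x.2
    rw [map_smul, map_smul, LinearMap.smul_apply, smul_add]

variable (D) in
/-- An operator as an element of the model. -/
def ofOper (P : ExtOp A K) : FormModel K D := (P, 0)

variable (D) in
/-- The multiple of a 1-form by `k` as an element of the model. -/
def ofForm (k : K) (ξ : Form A) : FormModel K D := (0, k ⊗ₜ ξ)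

theorem ofOper_add (P Q : ExtOp A K) : ofOper D (P + Q) = ofOper D P + ofOper D Q :=
  Prod.ext rfl (add_zero 0).symm

theorem ofOper_smul (k : K) (P : ExtOp A K) : ofOper D (k • P) = k • ofOper D P :=
  Prod.ext rfl (smul_zero k).symm

theorem ofOper_mul (P Q : ExtOp A K) : ofOper D (P * Q) = ofOper D P * ofOper D Q := by
  refine Prod.ext rfl ?_
  change 0 = left D P 0 + right Q 0
  rw [map_zero, map_zero, add_zero]

theorem ofForm_add (k : K) (ξ η : Form A) :
    ofForm D k (ξ + η) = ofForm D k ξ + ofForm D k η :=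
  Prod.ext (add_zero 0).symm (TensorProduct.tmul_add _ _ _)

theorem smul_ofForm (c k : K) (ξ : Form A) : c • ofForm D k ξ = ofForm D (c * k) ξ :=
  Prod.ext (smul_zero c) (TensorProduct.smul_tmul' _ _ _)

theorem ofForm_algebraMap_smul (k : K) (r : ℝ) (ξ : Form A) :
    ofForm D k (algebraMap ℝ A r • ξ) = algebraMap ℝ K r • ofForm D k ξ := by
  rw [smul_ofForm, ← Algebra.smul_def, algebraMap_smul]
  exact Prod.ext rfl (TensorProduct.smul_tmul _ _ _).symm

theorem ofForm_ne_zero {k : K} {ξ : Form A} (hk : k ≠ 0) (hξ : ξ ≠ 0) : ofForm D k ξ ≠ 0 :=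
  fun h => tmul_ne_zero K hk hξ (congrArg Prod.snd h)

theorem first_mul_ofForm (k l : K) (f : A) (X : Vec A) (ξ : Form A) :
    ofOper D (ExtOp.first k f X) * ofForm D l ξ =
      ofForm D (k * l) (f • ξ + D.nablaForm X ξ) := by
  refine Prod.ext (mul_zero _) ?_
  change left D (ExtOp.first k f X) (l ⊗ₜ ξ) + right 0 0 = _
  rw [map_zero, add_zero, left_first]
  rfl

theorem ofForm_mul_first (k l : K) (f : A) (X : Vec A) (ξ : Form A) :
    ofForm D l ξ * ofOper D (ExtOp.first k f X) = ofForm D (k * l) (f • ξ) := by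
  refine Prod.ext (zero_mul _) ?_
  change left D 0 0 + right (ExtOp.first k f X) (l ⊗ₜ ξ) = _
  rw [map_zero, zero_add, right_first]
  rfl

theorem nablaForm_zero (ξ : Form A) : D.nablaForm 0 ξ = 0 := by
  ext Z
  change (0 : A) - ξ (D.nablaLeft Z 0) = 0
  rw [map_zero, map_zero, sub_zero]

theorem left_one (n : K ⊗[ℝ] Form A) : left D 1 n = n := by
  induction n with
  | zero => exact map_zero _
  | add m n hm hn => rw [map_add, hm, hn]
  | tmul k ξ => rw [← ExtOp.first_one, left_first, nablaForm_zero, one_mul, one_smul, add_zero]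

theorem right_one (n : K ⊗[ℝ] Form A) : right 1 n = n := by
  induction n with
  | zero => exact map_zero _
  | add m n hm hn => rw [map_add, hm, hn]
  | tmul k ξ => rw [← ExtOp.first_one, right_first, one_mul, one_smul]

theorem ofOper_one_mul (x : FormModel K D) : ofOper D 1 * x = x := by
  refine Prod.ext (one_mul x.1) ?_
  change left D 1 x.2 + right x.1 0 = x.2
  rw [map_zero, add_zero, left_one]

theorem mul_ofOper_one (x : FormModel K D) : x * ofOper D 1 = x := by
  refine Prod.ext (mul_one x.1) ?_
  change left D x.1 0 + right 1 x.2 = x.2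
  rw [map_zero, zero_add, right_one]

end FormModel

end Model

end DiffOpCalculus

/-! ### Representation of the calculus in the model, and non-vanishing of the Jacobiator. -/

namespace DiffOpCalculus

section Representation

variable {A : Type*} [CommRing A] [Algebra ℝ A]

theorem lam_pow_two_ne_zero : lam ^ 2 ≠ 0 := by
  intro h
  rw [lam, ← AdjoinRoot.mk_X, ← map_pow, AdjoinRoot.mk_eq_zero] at h
  have := (pow_dvd_pow_iff Polynomial.X_ne_zero Polynomial.not_isUnit_X).1 h
  omega

theorem realScalar_eq_algebraMap (r : ℝ) : realScalar r = algebraMap ℝ Scalar r := by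
  rw [IsScalarTower.algebraMap_eq ℝ ℂ Scalar]
  rfl

/-- The generators of `𝒟` as operators on functions, a vector field `X` acting as `λ X`. -/
def DiffOp.reprGen : A ⊕ Vec A → ExtOp A Scalar :=
  Sum.elim (fun f => ExtOp.first 1 f 0) (fun X => ExtOp.first lam 0 X)

/-- The representation of `𝒟` by operators on functions. -/
def DiffOp.repr : DiffOp A →ₐ[Scalar] ExtOp A Scalar :=
  RingQuot.liftAlgHom Scalar ⟨FreeAlgebra.lift Scalar DiffOp.reprGen, fun x y h => by
    induction h with
    | fn_const r =>
      rw [FreeAlgebra.lift_ι_apply, AlgHom.commutes, realScalar_eq_algebraMap]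
      exact ExtOp.first_algebraMap r
    | fn_add f h =>
      simp only [map_add, FreeAlgebra.lift_ι_apply]
      simpa [DiffOp.reprGen] using ExtOp.first_add (1 : Scalar) f h 0 0
    | fn_mul f h =>
      simp only [map_mul, FreeAlgebra.lift_ι_apply]
      exact ExtOp.first_mul f h
    | vec_add X Y =>
      simp only [map_add, FreeAlgebra.lift_ι_apply]
      simpa [DiffOp.reprGen] using ExtOp.first_add lam 0 0 X Y
    | fn_vec f X =>
      simp only [map_mul, FreeAlgebra.lift_ι_apply]
      exact ExtOp.first_smul lam f X
    | vec_fn X f =>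
      simp only [map_sub, map_mul, map_smul, FreeAlgebra.lift_ι_apply]
      exact ExtOp.vec_fn_commutator lam X f
    | vec_vec Y X =>
      simp only [map_sub, map_mul, map_smul, FreeAlgebra.lift_ι_apply]
      exact ExtOp.vec_vec_commutator lam Y X⟩

theorem DiffOp.repr_fn (f : A) : DiffOp.repr (DiffOp.fn f) = ExtOp.first 1 f 0 := by
  rw [DiffOp.repr, DiffOp.fn, RingQuot.liftAlgHom_mkAlgHom_apply]
  exact FreeAlgebra.lift_ι_apply _ _

theorem DiffOp.repr_vec (X : Vec A) : DiffOp.repr (DiffOp.vec X) = ExtOp.first lam 0 X := by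
  rw [DiffOp.repr, DiffOp.vec, RingQuot.liftAlgHom_mkAlgHom_apply]
  exact FreeAlgebra.lift_ι_apply _ _

/-- The generators of the calculus in the model, where `θ'` is zero. -/
def FormModel.evalGen (D : Connection A) : Gen A → FormModel Scalar D
  | .op a => ofOper D (DiffOp.repr a)
  | .hat ξ => ofForm D 1 ξ
  | .theta => 0

/-- The homomorphism from the free algebra to the model. -/
def FormModel.eval (D : Connection A) : FreeCalc A →ₙₐ[Scalar] FormModel Scalar D :=
  FreeNonUnitalNonAssocAlgebra.lift Scalar (FormModel.evalGen D)

namespace FormModel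

variable {D : Connection A}

theorem eval_op (a : DiffOp A) : eval D (opF a) = ofOper D (DiffOp.repr a) :=
  FreeNonUnitalNonAssocAlgebra.lift_of_apply Scalar _ _

theorem eval_hat (ξ : Form A) : eval D (hatF ξ) = ofForm D 1 ξ :=
  FreeNonUnitalNonAssocAlgebra.lift_of_apply Scalar _ _

theorem eval_theta : eval D (thetaF : FreeCalc A) = 0 :=
  FreeNonUnitalNonAssocAlgebra.lift_of_apply Scalar _ _

/-- With `theta` sent to zero all quantum corrections drop out: functions multiply 1-forms
classically from either side, and only `[X, ξ̂] = λ (∇_X ξ)^` has to be matched. -/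
theorem eval_eq_of_relation {g : Metric A} {μ : ℝ} {x y : FreeCalc A} (h : Relation g μ x y) :
    eval g.leviCivita x = eval g.leviCivita y := by
  induction h with
  | op_add a b => rw [map_add, eval_op, eval_op, eval_op, map_add, ofOper_add]
  | op_smul k a => rw [map_smul, eval_op, eval_op, map_smul, ofOper_smul]
  | op_mul a b => rw [map_mul, eval_op, eval_op, eval_op, map_mul, ofOper_mul]
  | one_mul x => rw [map_mul, eval_op, map_one, ofOper_one_mul]
  | mul_one x => rw [map_mul, eval_op, map_one, mul_ofOper_one]
  | hat_add ξ η =>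
    rw [map_add, eval_hat, eval_hat, eval_hat, ofForm_add]
  | hat_smul r ξ =>
    rw [map_smul, eval_hat, eval_hat, realScalar_eq_algebraMap, ofForm_algebraMap_smul]
  | theta_comm a => rw [map_mul, map_mul, eval_theta, zero_mul, mul_zero]
  | theta_mul a b => simp only [map_mul, eval_theta, zero_mul]
  | mul_theta a b => simp only [map_mul, eval_theta, zero_mul, mul_zero]
  | fn_hat f ξ =>
    simp only [map_sub, map_mul, map_smul, eval_theta, zero_mul, smul_zero, sub_zero]
    rw [eval_op, eval_hat, eval_hat, DiffOp.repr_fn, first_mul_ofForm,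
      nablaForm_zero, one_mul, add_zero]
  | hat_fn f ξ =>
    simp only [map_add, map_mul, map_smul, eval_theta, zero_mul, smul_zero, add_zero]
    rw [eval_op, eval_hat, eval_hat, DiffOp.repr_fn, ofForm_mul_first, one_mul]
  | vec_hat X ξ =>
    -- The operator `λX` has zero function part, so both products contain the same term in `0 • ξ`;
    -- it cancels and leaves `λ∇_X ξ`.
    simp only [map_sub, map_mul, map_smul, eval_theta, zero_mul, smul_zero, sub_zero]
    rw [eval_op, eval_hat, eval_hat, DiffOp.repr_vec, ofForm_mul_first, first_mul_ofForm,
      smul_ofForm, ofForm_add, zero_smul, add_sub_cancel_left]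

/-- The kernel of `eval` is a two-sided ideal containing the relations, hence one of the submodules
whose intersection is `relIdeal`. -/
theorem eval_eq_zero {g : Metric A} {μ : ℝ} {x : FreeCalc A} (h : (Calc.mk x : Calc g μ) = 0) :
    eval g.leviCivita x = 0 := by
  have hx : x ∈ relIdeal g μ := (Submodule.Quotient.mk_eq_zero _).1 h
  simp only [relIdeal, Submodule.mem_sInf] at hx
  refine hx (LinearMap.ker
    (eval g.leviCivita : FreeCalc A →ₗ[Scalar] FormModel Scalar g.leviCivita))
    ⟨fun y z hyz => ?_, fun n hn y => ?_⟩
  · change eval g.leviCivita (y - z) = 0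
    rw [map_sub, eval_eq_of_relation hyz, sub_self]
  · have hn' : eval g.leviCivita n = 0 := hn
    constructor
    · change eval g.leviCivita (y * n) = 0
      rw [map_mul, hn', mul_zero]
    · change eval g.leviCivita (n * y) = 0
      rw [map_mul, hn', zero_mul]

end FormModel

namespace Calc

variable {g : Metric A} {μ : ℝ}

/-- At order `λ²` the symbol `ξ̂` of a nonzero 1-form is nonzero, even modulo `θ'`. -/
theorem lam_pow_two_smul_hat_sub_theta_ne_zero {ξ : Form A} (hξ : ξ ≠ 0) (k : Scalar)
    (a : DiffOp A) : lam ^ 2 • (hat g μ ξ - k • (theta g μ * op g μ a)) ≠ 0 := by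
  intro h
  have h' : (mk (lam ^ 2 • (hatF ξ - k • (thetaF * opF a))) : Calc g μ) = 0 := by
    rw [map_smul, map_sub, map_smul]
    exact h
  have h2 := FormModel.eval_eq_zero h'
  simp only [map_sub, map_mul, map_smul, FormModel.eval_theta, zero_mul, smul_zero, sub_zero] at h2
  rw [FormModel.eval_hat, FormModel.smul_ofForm, mul_one] at h2
  exact FormModel.ofForm_ne_zero lam_pow_two_ne_zero hξ h2

theorem exists_jacobiator_ne_zero_iff :
    (∃ (X Y : Vec A) (ξ : Form A), jacobiator (vec g μ Y) (vec g μ X) (hat g μ ξ) ≠ 0) ↔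
      ∃ X Y Z : Vec A, g.leviCivita.curvature X Y Z ≠ 0 := by
  constructor
  · rintro ⟨X, Y, ξ, h⟩
    by_contra! hR
    refine h ?_
    have hζ : g.leviCivita.curvatureForm ξ X Y = 0 := by
      ext Z
      change ξ (g.leviCivita.curvature X Y Z) = 0
      rw [hR, map_zero]
    rw [jacobiator_vec_vec_hat, hζ, map_zero, map_zero, map_zero, smul_zero, sub_zero, smul_zero]
  · rintro ⟨X, Y, Z, h⟩
    -- With `ξ` the 1-form dual to `Z`, `ζ♯ = -R(X,Y)Z`, so `ζ` is nonzero.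
    refine ⟨X, Y, g.sharp.symm Z, ?_⟩
    rw [jacobiator_vec_vec_hat]
    refine lam_pow_two_smul_hat_sub_theta_ne_zero (fun hζ => h ?_) _ _
    have hs := g.sharp_curvatureForm X Y (g.sharp.symm Z)
    rwa [hζ, map_zero, LinearEquiv.apply_symm_apply, eq_comm, neg_eq_zero] at hs

end Calc

end Representation

end DiffOpCalculus

end

theorem proposition4p1 {E : Type*} [NormedAddCommGroup E] [NormedSpace ℝ E]
    [FiniteDimensional ℝ E] {M : Type*} [TopologicalSpace M] [ChartedSpace E M]
    [IsManifold 𝓘(ℝ, E) ∞ M] [T2Space M] [SecondCountableTopology M]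
    (g : Metric (SmoothFn E M)) (μ : ℝ) (hμ : μ ≠ 0) :
    (∀ (f h : SmoothFn E M) (ξ : Form (SmoothFn E M)),
      jacobiator (fn g μ f) (fn g μ h) (hat g μ ξ) = 0) ∧
    (∀ (f : SmoothFn E M) (Y : Vec (SmoothFn E M)) (ξ : Form (SmoothFn E M)),
      jacobiator (fn g μ f) (vec g μ Y) (hat g μ ξ) = 0) ∧
    (∀ (X Y : Vec (SmoothFn E M)) (ξ : Form (SmoothFn E M)),
      jacobiator (vec g μ Y) (vec g μ X) (hat g μ ξ) =
        lam ^ 2 • (hat g μ (g.leviCivita.curvatureForm ξ X Y)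
          - realScalar μ⁻¹ •
            (theta g μ * vec g μ (g.sharp (g.leviCivita.curvatureForm ξ X Y))))) ∧
    (∀ (n : ℕ) (e : Fin n → Vec (SmoothFn E M)) (ε : Fin n → Form (SmoothFn E M)),
      IsDualFrame e ε → ∀ (X Y : Vec (SmoothFn E M)) (ξ : Form (SmoothFn E M)),
      jacobiator (vec g μ Y) (vec g μ X) (hat g μ ξ) =
        lam ^ 2 • ∑ a, ∑ c, ∑ i, ∑ j,
          fn g μ (ε a Y * ε c X * ξ (e i) * ε i (g.leviCivita.curvature (e c) (e a) (e j))) *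
            (hat g μ (ε j) - realScalar μ⁻¹ •
              ∑ k, theta g μ * (fn g μ (g.coInner (ε k) (ε j)) * vec g μ (e k)))) ∧
    ((∃ (X Y : Vec (SmoothFn E M)) (ξ : Form (SmoothFn E M)),
        jacobiator (vec g μ Y) (vec g μ X) (hat g μ ξ) ≠ 0) ↔
      ∃ X Y Z : Vec (SmoothFn E M), g.leviCivita.curvature X Y Z ≠ 0) := by
  refine ⟨jacobiator_fn_fn_hat, jacobiator_fn_vec_hat, jacobiator_vec_vec_hat,
    fun n e ε h => jacobiator_vec_vec_hat_frame h, exists_jacobiator_ne_zero_iff⟩
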